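/- Let $n\ge 0$ and $r\ge 2$ be integers. A $B_n$-partition is a partition $\pi$ of the set $[\pm n]=\{\pm1,\pm2,\ldots,\pm n\}$ into non-empty blocks such that for every block $B$ of $\pi$ the opposite set $-B$ is also a block of $\pi$, and at most one block $B$ of $\pi$ (called the zero-block) satisfies $B=-B$. The $B_n$-partitions are ordered by refinement: $\pi\le\pi'$ if every block of $\pi$ is contained in some block of $\pi'$. An $r$-tuple $(\pi_1,\ldots,\pi_r)$ of $B_n$-partitions is minimally intersecting if its meet $\pi_1\wedge\cdots\wedge\pi_r$ is the minimal partition $\{\{1\},\{-1\},\ldots,\{n\},\{-n\}\}$. Then the number $N^D_{n,r}$ of minimally intersecting $r$-tuples $(\pi_1,\ldots,\pi_r)$ of $B_n$-partitions without zero-block is \[ N^D_{n,r}=\frac{2^n}{e^{r/2}}\sum_{k_1,\ldots,k_r\ge 0}\frac{(2^{r-1}k_1k_2\cdots k_r)_n}{(2k_1)!!\,(2k_2)!!\cdots(2k_r)!!}, \] where the series on the right converges, $(x)_n=x(x-1)\cdots(x-n+1)$ is the falling factorial, and $(2k)!!=2\cdot4\cdots(2k)=2^k\,k!$ (so $0!!=1$).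 -/

import Mathlib

open scoped Pointwise Nat

/-- The set `[±n] = {±1, ±2, …, ±n}`, as a finite set of integers. -/
noncomputable def signedSet (n : ℕ) : Finset ℤ := (Finset.Icc (-(n : ℤ)) (n : ℤ)).erase 0

/-- A zero-block of a partition of `[±n]` is a block `B` with `B = -B`. -/
def IsZeroBlock {n : ℕ} (π : Finpartition (signedSet n)) (B : Finset ℤ) : Prop :=
  B ∈ π.parts ∧ B = -B

/-- A partition of `[±n]` is of type `B_n` if the opposite of every block is a block and there is
at most one zero-block. -/
def IsTypeB {n : ℕ} (π : Finpartition (signedSet n)) : Prop :=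
  (∀ B ∈ π.parts, -B ∈ π.parts) ∧
    ∀ B C : Finset ℤ, IsZeroBlock π B → IsZeroBlock π C → B = C

/-- The `B_n`-partitions. As a subtype of `Finpartition (signedSet n)` they are partially ordered
by refinement: `π ≤ π'` iff every block of `π` is contained in some block of `π'`. -/
abbrev BPartition (n : ℕ) : Type := {π : Finpartition (signedSet n) // IsTypeB π}

/-- The partition has no zero-block. -/
def BPartition.NoZeroBlock {n : ℕ} (π : BPartition n) : Prop :=
  ∀ B : Finset ℤ, ¬ IsZeroBlock π.1 B

theorem isTypeB_bot (n : ℕ) : IsTypeB (⊥ : Finpartition (signedSet n)) := by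
  have key : ∀ B : Finset ℤ, ¬ IsZeroBlock (⊥ : Finpartition (signedSet n)) B := by
    rintro B ⟨hB, hneg⟩
    obtain ⟨a, ha, rfl⟩ := Finpartition.mem_bot_iff.1 hB
    have h0 : a ≠ 0 := (Finset.mem_erase.1 ha).1
    rw [Finset.neg_singleton, Finset.singleton_inj] at hneg
    omega
  refine ⟨?_, fun B _ hB _ => absurd hB (key B)⟩
  intro B hB
  obtain ⟨a, ha, rfl⟩ := Finpartition.mem_bot_iff.1 hB
  refine Finpartition.mem_bot_iff.2 ⟨-a, ?_, (Finset.neg_singleton a).symm⟩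
  simp only [signedSet, Finset.mem_erase, Finset.mem_Icc] at ha ⊢
  omega

/-- The minimal `B_n`-partition `{{1}, {-1}, …, {n}, {-n}}`. -/
noncomputable def BPartition.minimal (n : ℕ) : BPartition n := ⟨⊥, isTypeB_bot n⟩

/-- `π_1, …, π_r` are minimally intersecting if their meet (the largest `B_n`-partition which
refines all of them) exists and is the minimal partition. -/
def MinimallyIntersecting {n r : ℕ} (π : Fin r → BPartition n) : Prop :=
  IsGLB (Set.range π) (BPartition.minimal n)

/-- The set of minimally intersecting `r`-tuples of `B_n`-partitions without zero-block. -/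
def minIntersectingTuplesD (n r : ℕ) : Set (Fin r → BPartition n) :=
  {π | (∀ t, (π t).NoZeroBlock) ∧ MinimallyIntersecting π}

/-- This set is finite, so that its cardinality `Set.ncard` is meaningful. -/
theorem finite_minIntersectingTuplesD (n r : ℕ) : (minIntersectingTuplesD n r).Finite :=
  Set.toFinite _

/-- The number `N^D_{n,r}`. -/
noncomputable def numD (n r : ℕ) : ℕ := (minIntersectingTuplesD n r).ncard

/-!
The identity is a Dobiński-type formula with the group of order two acting throughout.

The set `[±n]` with `x ↦ -x` is a free involution with `n` orbits, and an equivariant map from it to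
another free involution has as its fibres the blocks of a `B_n`-partition without zero-block (a
zero-block would give a fixed point). Fix `k : Fin r → ℕ` and consider the equivariant injections of
`[±n]` into the product of the free involutions `Fin (k t) × Bool`, which has `2 ^ (r - 1) * ∏ k t`
orbits. There are `2 ^ n * (2 ^ (r - 1) * ∏ k t).descFactorial n` of them, since an equivariant
injection is an injection on orbits and a sign for every orbit of the source
(`IsFreeInvolution.card_equivariantInjection`). On the other hand, the tuple of fibre partitions
of the components is minimally intersecting exactly because the joint map is injective, and for a
given such tuple `π` the `t`-th component is an equivariant injection of the blocks of `π t`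
into `Fin (k t) × Bool` (`card_equivariantInjection_pi`). So, with `2 * j t` the number of blocks
of `π t`,
`2 ^ n * (2 ^ (r - 1) * ∏ k t).descFactorial n = ∑ π, ∏ t, 2 ^ j t * (k t).descFactorial (j t)`,
which is `sum_minIntersectingTuplesD`.

Finally, divide by `∏ t, (2 * k t)‼` and sum over `k`. Each factor sums to `exp (1 / 2)`, whatever
`j t` is (`hasSum_descFactorial_div_doubleFactorial`: the factorial moments of the Poisson
distribution of parameter `1 / 2`), so every tuple `π` contributes `exp (r / 2)`.
-/

/-! ### Equivariant injections between free involutions -/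

/-- A fixed-point-free involution, i.e. a free action of the group with two elements. -/
structure IsFreeInvolution {X : Type*} (σ : X → X) : Prop where
  involutive : Function.Involutive σ
  ne : ∀ x, σ x ≠ x

/-- The injective maps `X → Y` that intertwine `σ` and `τ`. -/
abbrev EquivariantInjection {X Y : Type*} (σ : X → X) (τ : Y → Y) : Type _ :=
  {f : X → Y // Function.Injective f ∧ Function.Semiconj f σ τ}

/-- The standard free involution with orbit set `α`: swap the two copies of `α` in `α × Bool`. -/
def swapCopies (α : Type*) (x : α × Bool) : α × Bool := (x.1, !x.2)

theorem isFreeInvolution_swapCopies (α : Type*) : IsFreeInvolution (swapCopies α) where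
  involutive x := by simp [swapCopies]
  ne x h := by simpa [swapCopies] using congrArg Prod.snd h

theorem IsFreeInvolution.pi {ι : Type*} [Nonempty ι] {Y : ι → Type*} {τ : ∀ i, Y i → Y i}
    (h : ∀ i, IsFreeInvolution (τ i)) :
    IsFreeInvolution (fun (y : ∀ i, Y i) i => τ i (y i)) where
  involutive _ := funext fun i => (h i).involutive _
  ne _ hy := (h (Classical.arbitrary ι)).ne _ (congrFun hy _)

/-- A finite free involution is standard: its orbits have two elements, and a choice of
representatives identifies it with two copies of the orbit set. -/
theorem IsFreeInvolution.exists_equiv_swapCopies {X : Type*} [Finite X] {σ : X → X}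
    (h : IsFreeInvolution σ) :
    ∃ e : X ≃ Fin (Nat.card X / 2) × Bool, Function.Semiconj e σ (swapCopies _) := by
  classical
  let s : Setoid X :=
    { r := fun x y => y = x ∨ y = σ x
      iseqv :=
        { refl := fun x => Or.inl rfl
          symm := by
            rintro x y (rfl | rfl)
            · exact Or.inl rfl
            · exact Or.inr (h.involutive x).symm
          trans := by
            rintro x y z (rfl | rfl) (rfl | rfl)
            · exact Or.inl rfl
            · exact Or.inr rfl
            · exact Or.inr rfl
            · exact Or.inl (h.involutive x) } }
  let g : Quotient s × Bool → X := fun p => if p.2 then σ p.1.out else p.1.out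
  have hgmk : ∀ p, (⟦g p⟧ : Quotient s) = p.1 := by
    rintro ⟨q, b⟩
    have hq : (⟦σ q.out⟧ : Quotient s) = ⟦q.out⟧ :=
      Quotient.sound (s := s) (Or.inr (h.involutive _).symm)
    cases b
    · simp [g]
    · simp [g, hq]
  have hg : Function.Bijective g := by
    constructor
    · rintro ⟨q, b⟩ ⟨q', b'⟩ hqq
      obtain rfl : q = q' := (hgmk (q, b)).symm.trans ((congrArg _ hqq).trans (hgmk (q', b')))
      cases b <;> cases b'
      · rfl
      · exact absurd hqq.symm (h.ne q.out)
      · exact absurd hqq (h.ne q.out)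
      · rfl
    · intro x
      have hx : s (⟦x⟧ : Quotient s).out x := Quotient.exact (Quotient.out_eq _)
      rcases hx with hx | hx
      · exact ⟨(⟦x⟧, false), by simpa [g] using hx.symm⟩
      · exact ⟨(⟦x⟧, true), by simpa [g] using hx.symm⟩
  have hgflip : ∀ p, g (swapCopies _ p) = σ (g p) := by
    rintro ⟨q, b⟩
    cases b
    · rfl
    · exact (h.involutive _).symm
  have hcard : Nat.card X / 2 = Nat.card (Quotient s) := by
    rw [← Nat.card_congr (Equiv.ofBijective g hg), Nat.card_prod]
    simp
  rw [hcard]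
  refine ⟨(Equiv.ofBijective g hg).symm.trans
    ((Finite.equivFin (Quotient s)).prodCongr (Equiv.refl _)), fun x => ?_⟩
  obtain ⟨p, rfl⟩ := hg.2 x
  rw [← hgflip]
  have hs : ∀ p, (Equiv.ofBijective g hg).symm (g p) = p :=
    (Equiv.ofBijective g hg).symm_apply_apply
  simp [hs, swapCopies]

theorem card_equivariantInjection_congr {X X' Y Y' : Type*} {σ : X → X} {σ' : X' → X'}
    {τ : Y → Y} {τ' : Y' → Y'} (e : X ≃ X') (he : Function.Semiconj e σ σ')
    (e' : Y ≃ Y') (he' : Function.Semiconj e' τ τ') :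
    Nat.card (EquivariantInjection σ τ) = Nat.card (EquivariantInjection σ' τ') := by
  refine Nat.card_congr ((e.arrowCongr e').subtypeEquiv fun f => ?_)
  have hs : Function.Semiconj e.symm σ' σ := he.inverse_left e.left_inv e.right_inv
  have hs' : Function.Semiconj e'.symm τ' τ := he'.inverse_left e'.left_inv e'.right_inv
  refine and_congr ?_ ⟨fun hf => he'.comp_left (hf.comp_left hs), fun hf x => ?_⟩
  · simp [Equiv.arrowCongr, Function.Injective.of_comp_iff e'.injective]
  · have := hf (e x)
    simpa [← he.eq, ← he'.eq] using this

/-- An equivariant injection `α × Bool → β × Bool` is an injection between the orbit sets together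
with a choice, for every orbit, of one of the two equivariant bijections onto its image. -/
theorem card_equivariantInjection_swapCopies (m q : ℕ) :
    Nat.card (EquivariantInjection (swapCopies (Fin m)) (swapCopies (Fin q))) =
      2 ^ m * q.descFactorial m := by
  let Φ : (Fin m → Bool) × (Fin m ↪ Fin q) →
      EquivariantInjection (swapCopies (Fin m)) (swapCopies (Fin q)) := fun p =>
    ⟨fun x => (p.2 x.1, xor x.2 (p.1 x.1)), by
      rintro ⟨i, b⟩ ⟨j, c⟩ h
      simp only [Prod.mk.injEq, EmbeddingLike.apply_eq_iff_eq] at h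
      obtain ⟨rfl, h⟩ := h
      simpa using h, by
      rintro ⟨i, b⟩
      simp [swapCopies]⟩
  have hΦ : Function.Bijective Φ := by
    constructor
    · rintro ⟨ε, s⟩ ⟨ε', s'⟩ h
      have h' : ∀ i, s i = s' i ∧ ε i = ε' i := fun i => by
        simpa [Φ] using congrFun (congrArg Subtype.val h) (i, false)
      exact Prod.ext (funext fun i => (h' i).2) (DFunLike.ext _ _ fun i => (h' i).1)
    · rintro ⟨f, hf, hc⟩
      have hfalse : ∀ i, f (i, true) = swapCopies _ (f (i, false)) := fun i => hc (i, false)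
      refine ⟨⟨fun i => (f (i, false)).2, fun i => (f (i, false)).1, fun i j hij => ?_⟩, ?_⟩
      · by_cases hb : (f (i, false)).2 = (f (j, false)).2
        · exact congrArg Prod.fst (hf (Prod.ext hij hb))
        · have : f (i, false) = f (j, true) := by
            rw [hfalse]
            exact Prod.ext hij (by simpa [swapCopies] using Bool.eq_not_of_ne hb)
          exact congrArg Prod.fst (hf this)
      · refine Subtype.ext (funext ?_)
        rintro ⟨i, b⟩
        cases b
        · exact Prod.ext rfl (by simp [Φ])
        · refine Eq.trans ?_ (hfalse i).symm
          exact Prod.ext rfl (by simp [Φ, swapCopies])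
  rw [← Nat.card_congr (Equiv.ofBijective Φ hΦ), Nat.card_prod]
  simp [Nat.card_eq_fintype_card, Fintype.card_embedding_eq]

/-- `Nat.card X / 2` is the number of orbits, `Nat.card X` being even. -/
theorem IsFreeInvolution.card_equivariantInjection {X Y : Type*} [Finite X] [Finite Y]
    {σ : X → X} {τ : Y → Y} (hσ : IsFreeInvolution σ) (hτ : IsFreeInvolution τ) :
    Nat.card (EquivariantInjection σ τ) =
      2 ^ (Nat.card X / 2) * (Nat.card Y / 2).descFactorial (Nat.card X / 2) := by
  obtain ⟨e, he⟩ := hσ.exists_equiv_swapCopies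
  obtain ⟨e', he'⟩ := hτ.exists_equiv_swapCopies
  rw [card_equivariantInjection_congr e he e' he', card_equivariantInjection_swapCopies]

/-! ### Blocks of partitions without zero-block -/

theorem neg_mem_signedSet {n : ℕ} {x : ℤ} (hx : x ∈ signedSet n) : -x ∈ signedSet n := by
  simp only [signedSet, Finset.mem_erase, Finset.mem_Icc] at hx ⊢
  omega

/-- Negation on `[±n]`. -/
def signedNeg (n : ℕ) (x : signedSet n) : signedSet n := ⟨-x.1, neg_mem_signedSet x.2⟩

theorem isFreeInvolution_signedNeg (n : ℕ) : IsFreeInvolution (signedNeg n) where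
  involutive x := Subtype.ext (neg_neg x.1)
  ne x h := by
    have h0 : x.1 ≠ 0 := (Finset.mem_erase.1 x.2).1
    have : -x.1 = x.1 := congrArg Subtype.val h
    omega

theorem card_signedSet (n : ℕ) : Nat.card (signedSet n) = 2 * n := by
  rw [Nat.card_eq_fintype_card, Fintype.card_coe, signedSet,
    Finset.card_erase_of_mem (by simp), Int.card_Icc]
  omega

/-- `B ↦ -B` on the blocks of a `B_n`-partition. -/
def blockNeg {n : ℕ} (π : BPartition n) (B : π.1.parts) : π.1.parts := ⟨-B.1, π.2.1 _ B.2⟩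

theorem BPartition.NoZeroBlock.isFreeInvolution_blockNeg {n : ℕ} {π : BPartition n}
    (h : π.NoZeroBlock) : IsFreeInvolution (blockNeg π) where
  involutive B := Subtype.ext (neg_neg B.1)
  ne B hB := h B.1 ⟨B.2, (congrArg Subtype.val hB).symm⟩

/-- The block containing a given element of `[±n]`. -/
noncomputable def blockOf {n : ℕ} (π : BPartition n) (x : signedSet n) : π.1.parts :=
  ⟨π.1.part x.1, π.1.part_mem.2 x.2⟩

theorem blockOf_surjective {n : ℕ} (π : BPartition n) : Function.Surjective (blockOf π) := by
  rintro ⟨B, hB⟩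
  obtain ⟨x, hx, hxB⟩ := π.1.part_surjOn hB
  exact ⟨⟨x, hx⟩, Subtype.ext hxB⟩

theorem semiconj_blockOf {n : ℕ} (π : BPartition n) :
    Function.Semiconj (blockOf π) (signedNeg n) (blockNeg π) := fun x =>
  Subtype.ext (π.1.part_eq_of_mem (π.2.1 _ (π.1.part_mem.2 x.2))
    (Finset.neg_mem_neg (π.1.mem_part x.2)))

theorem blockOf_eq_iff {n : ℕ} {π : BPartition n} {x y : signedSet n} :
    blockOf π x = blockOf π y ↔ x.1 ∈ π.1.part y.1 := by
  rw [π.1.mem_part_iff_part_eq_part x.2 y.2]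
  exact Subtype.ext_iff

/-- Refinement of partitions is inclusion of the associated equivalence relations. -/
theorem BPartition.le_iff {n : ℕ} {π ρ : BPartition n} :
    π ≤ ρ ↔ ∀ x y, blockOf π x = blockOf π y → blockOf ρ x = blockOf ρ y := by
  constructor
  · intro h x y hxy
    obtain ⟨C, hC, hle⟩ := h (π.1.part_mem.2 y.2)
    have hx := hle (blockOf_eq_iff.1 hxy)
    have hy := hle (π.1.mem_part y.2)
    exact Subtype.ext ((ρ.1.part_eq_of_mem hC hx).trans (ρ.1.part_eq_of_mem hC hy).symm)
  · intro h B hB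
    obtain ⟨y, hy⟩ := blockOf_surjective π ⟨B, hB⟩
    obtain rfl : π.1.part y.1 = B := congrArg Subtype.val hy
    refine ⟨ρ.1.part y.1, ρ.1.part_mem.2 y.2, fun x hx => ?_⟩
    have hxs : x ∈ signedSet n := π.1.part_subset _ hx
    exact blockOf_eq_iff.1 (h ⟨x, hxs⟩ y (blockOf_eq_iff.2 hx))

theorem blockOf_minimal_injective (n : ℕ) :
    Function.Injective (blockOf (BPartition.minimal n)) := by
  intro x y hxy
  obtain ⟨a, -, ha⟩ := Finpartition.mem_bot_iff.1 (blockOf (BPartition.minimal n) y).2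
  have hx : x.1 ∈ (blockOf (BPartition.minimal n) y).1 := blockOf_eq_iff.1 hxy
  have hy : y.1 ∈ (blockOf (BPartition.minimal n) y).1 := blockOf_eq_iff.1 rfl
  rw [← ha, Finset.mem_singleton] at hx hy
  exact Subtype.ext (hx.trans hy.symm)

/-- An equivariant map from `[±n]` to a free involution factors as the block map of a partition
without zero-block followed by an equivariant injection: the blocks are the fibres of the map, and
a zero-block would produce a fixed point. -/
theorem exists_factorization {n : ℕ} {Y : Type*} {τ : Y → Y} (hτ : IsFreeInvolution τ)
    {f : signedSet n → Y} (hf : Function.Semiconj f (signedNeg n) τ) :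
    ∃ π : BPartition n, π.NoZeroBlock ∧ ∃ g : EquivariantInjection (blockNeg π) τ,
      ∀ x, g.1 (blockOf π x) = f x := by
  classical
  -- `Finpartition.ofSetSetoid` takes a setoid on all of `ℤ`, so `f` is extended by `none`.
  let F : ℤ → Option Y := fun x => if h : x ∈ signedSet n then some (f ⟨x, h⟩) else none
  have hF : ∀ x : signedSet n, F x = some (f x) := fun x => dif_pos x.2
  let P : Finpartition (signedSet n) := Finpartition.ofSetSetoid (Setoid.ker F) (signedSet n)
  have hmem : ∀ x y : signedSet n, y.1 ∈ P.part x.1 ↔ f x = f y := fun x y => by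
    rw [Finpartition.mem_part_ofSetSetoid_iff_rel, Setoid.ker_def, hF, hF, Option.some_inj]
    exact ⟨fun h => h.2.2, fun h => ⟨x.2, y.2, h⟩⟩
  have hpart : ∀ B ∈ P.parts, ∃ x : signedSet n, P.part x.1 = B := fun B hB => by
    obtain ⟨x, hx, hxB⟩ := P.part_surjOn hB
    exact ⟨⟨x, hx⟩, hxB⟩
  have hneg : ∀ x : signedSet n, -P.part x.1 = P.part (signedNeg n x).1 := fun x => by
    ext y
    rw [Finset.mem_neg']
    constructor
    · intro hy
      have hys : -y ∈ signedSet n := P.part_subset _ hy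
      have h := (hmem x ⟨-y, hys⟩).1 hy
      have hy' : y ∈ signedSet n := by simpa using neg_mem_signedSet hys
      refine (hmem _ ⟨y, hy'⟩).2 ?_
      rw [hf, h, ← hf]
      exact congrArg f (Subtype.ext (neg_neg y))
    · intro hy
      have hys : y ∈ signedSet n := P.part_subset _ hy
      have h := (hmem _ ⟨y, hys⟩).1 hy
      refine (hmem x (signedNeg n ⟨y, hys⟩)).2 ?_
      rw [hf, ← h, hf, hτ.involutive]
  have hzero : ∀ B, ¬ IsZeroBlock P B := by
    rintro B ⟨hB, hBneg⟩
    obtain ⟨x, rfl⟩ := hpart B hB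
    have hx : (signedNeg n x).1 ∈ P.part x.1 := by
      rw [hBneg, hneg]
      exact P.mem_part (signedNeg n x).2
    have := (hmem _ _).1 hx
    rw [hf] at this
    exact hτ.ne _ this.symm
  have hB : IsTypeB P := by
    refine ⟨fun B hB => ?_, fun B _ h _ => absurd h (hzero B)⟩
    obtain ⟨x, rfl⟩ := hpart B hB
    rw [hneg]
    exact P.part_mem.2 (signedNeg n x).2
  let π : BPartition n := ⟨P, hB⟩
  have hker : ∀ x y, blockOf π x = blockOf π y ↔ f x = f y := fun x y => by
    rw [blockOf_eq_iff, hmem, eq_comm]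
  let g : π.1.parts → Y := fun B => f (Function.surjInv (blockOf_surjective π) B)
  have hg : ∀ x, g (blockOf π x) = f x := fun x =>
    (hker _ _).1 (Function.surjInv_eq (blockOf_surjective π) _)
  refine ⟨π, hzero, ⟨g, fun B C h => ?_, fun B => ?_⟩, hg⟩
  · obtain ⟨x, rfl⟩ := blockOf_surjective π B
    obtain ⟨y, rfl⟩ := blockOf_surjective π C
    rw [hg, hg] at h
    exact (hker x y).2 h
  · obtain ⟨x, rfl⟩ := blockOf_surjective π B
    rw [← semiconj_blockOf, hg, hg, hf]

/-- For partitions without zero-block the meet is the common refinement, which is again a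
partition without zero-block. So it is minimal iff no two elements share a block in all of the
partitions. -/
theorem minimallyIntersecting_iff {n r : ℕ} (hr : r ≠ 0) {π : Fin r → BPartition n}
    (h : ∀ t, (π t).NoZeroBlock) :
    MinimallyIntersecting π ↔
      Function.Injective fun (x : signedSet n) (t : Fin r) => blockOf (π t) x := by
  have : NeZero r := ⟨hr⟩
  constructor
  · intro hmin x y hxy
    obtain ⟨ρ, -, g, hg⟩ := exists_factorization
      (f := fun (x : signedSet n) (t : Fin r) => blockOf (π t) x)
      (IsFreeInvolution.pi fun t => (h t).isFreeInvolution_blockNeg)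
      (fun x => funext fun t => semiconj_blockOf (π t) x)
    -- `ρ` is the common refinement of the `π t`.
    have hle : ρ ≤ BPartition.minimal n := by
      refine hmin.2 ?_
      rintro _ ⟨t, rfl⟩
      refine BPartition.le_iff.2 fun x y hxy => ?_
      have := congrArg g.1 hxy
      rw [hg, hg] at this
      exact congrFun this t
    refine blockOf_minimal_injective n (BPartition.le_iff.1 hle x y (g.2.1 ?_))
    rw [hg, hg]
    exact hxy
  · intro hinj
    refine ⟨?_, fun ρ hρ => BPartition.le_iff.2 fun x y hxy => ?_⟩
    · rintro _ ⟨t, rfl⟩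
      exact BPartition.le_iff.2 fun x y hxy => by rw [blockOf_minimal_injective n hxy]
    · have : x = y := hinj (funext fun t => BPartition.le_iff.1 (hρ ⟨t, rfl⟩) x y hxy)
      rw [this]

/-! ### Equivariant injections of `[±n]` into a product -/

/-- An equivariant injection of `[±n]` into a product of free involutions amounts to a minimally
intersecting tuple (the fibres of its components) and an equivariant injection from the
blocks of each partition to the corresponding factor. -/
theorem card_equivariantInjection_pi {n r : ℕ} (hr : r ≠ 0) {Y : Fin r → Type*}
    {τ : ∀ t, Y t → Y t} (hτ : ∀ t, IsFreeInvolution (τ t)) :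
    Nat.card (EquivariantInjection (signedNeg n) fun (y : ∀ t, Y t) t => τ t (y t)) =
      Nat.card (Σ π : minIntersectingTuplesD n r,
        ∀ t, EquivariantInjection (blockNeg (π.1 t)) (τ t)) := by
  symm
  let Φ : (Σ π : minIntersectingTuplesD n r,
      ∀ t, EquivariantInjection (blockNeg (π.1 t)) (τ t)) →
      EquivariantInjection (signedNeg n) fun (y : ∀ t, Y t) t => τ t (y t) := fun p =>
    ⟨fun x t => (p.2 t).1 (blockOf (p.1.1 t) x),
      fun x y hxy => (minimallyIntersecting_iff hr p.1.2.1).1 p.1.2.2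
        (funext fun t => (p.2 t).2.1 (congrFun hxy t)),
      fun x => funext fun t =>
        (congrArg _ (semiconj_blockOf (p.1.1 t) x)).trans ((p.2 t).2.2 _)⟩
  have hΦ : ∀ p x t, (Φ p).1 x t = (p.2 t).1 (blockOf (p.1.1 t) x) := fun _ _ _ => rfl
  refine Nat.card_congr (Equiv.ofBijective Φ ⟨?_, ?_⟩)
  · intro p p' hpp
    have hval : ∀ x t, (p.2 t).1 (blockOf (p.1.1 t) x) = (p'.2 t).1 (blockOf (p'.1.1 t) x) :=
      fun x t => by rw [← hΦ, ← hΦ, hpp]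
    obtain ⟨⟨π, hπ⟩, g⟩ := p
    obtain ⟨⟨π', hπ'⟩, g'⟩ := p'
    dsimp only at hval
    obtain rfl : π = π' := by
      funext t
      refine le_antisymm (BPartition.le_iff.2 fun x y hxy => (g' t).2.1 ?_)
        (BPartition.le_iff.2 fun x y hxy => (g t).2.1 ?_)
      · rw [← hval, ← hval, hxy]
      · rw [hval, hval, hxy]
    obtain rfl : g = g' := by
      funext t
      refine Subtype.ext (funext fun B => ?_)
      obtain ⟨x, rfl⟩ := blockOf_surjective _ B
      exact hval x t
    rfl
  · intro F
    have hF : ∀ t, Function.Semiconj (fun x => F.1 x t) (signedNeg n) (τ t) :=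
      fun t x => congrFun (F.2.2 x) t
    choose π hπ g hg using fun t => exists_factorization (hτ t) (hF t)
    refine ⟨⟨⟨π, hπ, (minimallyIntersecting_iff hr hπ).2 fun x y hxy => F.2.1 ?_⟩, g⟩, ?_⟩
    · funext t
      rw [← hg, ← hg]
      exact congrArg _ (congrFun hxy t)
    · exact Subtype.ext (funext fun x => funext fun t => hg t x)

/-- The finite identity behind the series: both sides count the equivariant injections of `[±n]`
into the product of the free involutions `Fin (k t) × Bool`. -/
theorem sum_minIntersectingTuplesD {n r : ℕ} (hr : r ≠ 0) (k : Fin r → ℕ)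
    [Fintype (minIntersectingTuplesD n r)] :
    2 ^ n * (2 ^ (r - 1) * ∏ t, k t).descFactorial n =
      ∑ π : minIntersectingTuplesD n r, ∏ t,
        2 ^ (Nat.card (π.1 t).1.parts / 2) *
          (k t).descFactorial (Nat.card (π.1 t).1.parts / 2) := by
  have : NeZero r := ⟨hr⟩
  have hτ : ∀ t, IsFreeInvolution (swapCopies (Fin (k t))) := fun t => isFreeInvolution_swapCopies _
  have hcard : Nat.card (∀ t, Fin (k t) × Bool) / 2 = 2 ^ (r - 1) * ∏ t, k t := by
    have hpi : Nat.card (∀ t, Fin (k t) × Bool) = 2 * (2 ^ (r - 1) * ∏ t, k t) := by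
      rw [← mul_assoc, ← pow_succ', Nat.sub_add_cancel (Nat.one_le_iff_ne_zero.2 hr)]
      simp [Finset.prod_mul_distrib, mul_comm]
    rw [hpi, Nat.mul_div_cancel_left _ two_pos]
  have h := card_equivariantInjection_pi (n := n) hr hτ
  rw [(isFreeInvolution_signedNeg n).card_equivariantInjection (IsFreeInvolution.pi hτ), hcard,
    card_signedSet, Nat.mul_div_cancel_left _ two_pos, Nat.card_sigma] at h
  rw [h]
  refine Finset.sum_congr rfl fun π _ => ?_
  rw [Nat.card_pi]
  refine Finset.prod_congr rfl fun t _ => ?_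
  rw [(π.2.1 t).isFreeInvolution_blockNeg.card_equivariantInjection (hτ t), Nat.card_prod]
  simp

/-! ### Summation over the sizes of the factors -/

/-- The terms with `k < j` vanish; shifting by `j` leaves the exponential series at `1 / 2`. -/
theorem hasSum_descFactorial_div_doubleFactorial (j : ℕ) :
    HasSum (fun k : ℕ => ((2 ^ j * k.descFactorial j : ℕ) : ℝ) / (((2 * k)‼ : ℕ) : ℝ))
      (Real.exp (1 / 2)) := by
  have h := NormedSpace.expSeries_div_hasSum_exp (1 / 2 : ℝ)
  rw [← Real.exp_eq_exp_ℝ] at h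
  rw [← (add_left_injective j).hasSum_iff]
  · refine h.congr_fun fun k => ?_
    have hk : ((k + j).descFactorial j : ℝ) * k ! = (k + j)! := by
      have := Nat.factorial_mul_descFactorial (Nat.le_add_left j k)
      rw [Nat.add_sub_cancel] at this
      rw [mul_comm]
      exact_mod_cast this
    have h1 : ((k + j)! : ℝ) ≠ 0 := by positivity
    have h2 : (k ! : ℝ) ≠ 0 := by positivity
    simp only [Function.comp_apply, Nat.doubleFactorial_two_mul, Nat.cast_mul, Nat.cast_pow,
      Nat.cast_ofNat, ← hk, pow_add, one_div, inv_pow]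
    have h3 : ((k + j).descFactorial j : ℝ) ≠ 0 := fun h0 => h1 (by rw [← hk, h0, zero_mul])
    field_simp
  · intro k hk
    have : k < j := by
      by_contra! hle
      exact hk ⟨k - j, Nat.sub_add_cancel hle⟩
    simp [Nat.descFactorial_of_lt this]

theorem hasSum_prod_of_nonneg {r : ℕ} {f : Fin r → ℕ → ℝ} {a : Fin r → ℝ}
    (hf : ∀ t, HasSum (f t) (a t)) (h0 : ∀ t k, 0 ≤ f t k) :
    HasSum (fun k : Fin r → ℕ => ∏ t, f t (k t)) (∏ t, a t) := by
  induction r with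
  | zero => simp
  | succ r ih =>
    have ih' := ih (fun t => hf t.succ) (fun t => h0 t.succ)
    have hs := (hf 0).summable.mul_of_nonneg ih'.summable (h0 0)
      (fun k => Finset.prod_nonneg fun t _ => h0 _ _)
    have hp := (hf 0).mul ih' hs
    rw [← (Fin.consEquiv fun _ => ℕ).hasSum_iff]
    simpa [Function.comp_def, Fin.prod_univ_succ] using hp

/-! ### The series -/

theorem theorem3p4 (n r : ℕ) (hr : 2 ≤ r) :
    Summable (fun k : Fin r → ℕ =>
      ((Nat.descFactorial (2 ^ (r - 1) * ∏ t, k t) n : ℕ) : ℝ) / ∏ t, (((2 * k t)‼ : ℕ) : ℝ)) ∧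
    (numD n r : ℝ) = (2 : ℝ) ^ n / Real.exp ((r : ℝ) / 2) *
      ∑' k : Fin r → ℕ,
        ((Nat.descFactorial (2 ^ (r - 1) * ∏ t, k t) n : ℕ) : ℝ) / ∏ t, (((2 * k t)‼ : ℕ) : ℝ) := by
  classical
  have : Fintype (minIntersectingTuplesD n r) := Fintype.ofFinite _
  have hexp : ∏ _t : Fin r, Real.exp (1 / 2) = Real.exp ((r : ℝ) / 2) := by
    rw [← Real.exp_sum]
    simp [div_eq_mul_inv]
  have hsum : HasSum (fun k : Fin r → ℕ => (2 : ℝ) ^ n *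
      (((Nat.descFactorial (2 ^ (r - 1) * ∏ t, k t) n : ℕ) : ℝ) /
        ∏ t, (((2 * k t)‼ : ℕ) : ℝ))) (numD n r * Real.exp ((r : ℝ) / 2)) := by
    have h := hasSum_sum (s := Finset.univ) fun (π : minIntersectingTuplesD n r) _ =>
      hasSum_prod_of_nonneg
        (fun t => hasSum_descFactorial_div_doubleFactorial (Nat.card (π.1 t).1.parts / 2))
        (fun t k => by positivity)
    rw [hexp, Finset.sum_const, nsmul_eq_mul, Finset.card_univ, ← Nat.card_eq_fintype_card,
      Nat.card_coe_set_eq] at h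
    refine h.congr_fun fun k => ?_
    rw [← mul_div_assoc]
    simp only [Finset.prod_div_distrib, ← Finset.sum_div]
    congr 1
    exact_mod_cast sum_minIntersectingTuplesD (n := n) (by omega : r ≠ 0) k
  have h2 : (2 : ℝ) ^ n ≠ 0 := by positivity
  refine ⟨(summable_mul_left_iff h2).1 hsum.summable, ?_⟩
  rw [div_mul_eq_mul_div, ← tsum_mul_left, hsum.tsum_eq, mul_div_cancel_right₀ _ (Real.exp_ne_zero _)]
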